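/- For integers $1\le k\le n\le m$, the generalized Simon's problem with parameters $(n,m,k)$ is: given oracle access to a function $f:\{0,1\}^n\to\{0,1\}^m$, promised that for some $S\subseteq\{0,1\}^n$ with $|S|=2^k$ one has, for all $x,y\in\{0,1\}^n$, $f(x)=f(y)\iff x\oplus y\in S$, find the set $S$. A quantum algorithm with $T$ queries starts in a fixed unit vector of the space spanned by the basis states $|x,y,z\rangle$ ($x\in\{0,1\}^n$, $y\in\{0,1\}^m$, $z$ in a finite workspace), applies $U_T O_f U_{T-1}\cdots U_1 O_f U_0$, where $U_0,\dots,U_T$ are unitaries not depending on $f$ and $O_f|x,y,z\rangle=|x,y\oplus f(x),z\rangle$, measures in the computational basis, and returns a function of the measured basis label. It is exact if, for every $f$ satisfying the promise, it returns $S$ with probability $1$. Any exact quantum algorithm that solves the generalized Simon's problem requires $\Omega(n-k)$ queries: there is an absolute constant $c>0$ such that, for all $1\le k\le n\le m$, every exact quantum algorithm for the generalized Simon's problem with parameters $(n,m,k)$ that makes $T$ queries, with any finite workspace, satisfies $T\ge c\,(n-k)$. -/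

import Mathlib

/-- Bit strings `{0,1}^n`; addition is the bitwise exclusive-or. -/
abbrev BitString (n : ℕ) : Type := Fin n → ZMod 2

/-- The promise of the generalized Simon problem with parameters `n, m, k`:
`S` has `2^k` elements, and `f x = f y` exactly when `x ⊕ y ∈ S`. -/
def SimonPromise {n m : ℕ} (k : ℕ) (f : BitString n → BitString m)
    (S : Set (BitString n)) : Prop :=
  S.ncard = 2 ^ k ∧ ∀ x y : BitString n, f x = f y ↔ x + y ∈ S

/-- Labels `(x, y, z)` of the computational basis: an `n`-bit query register, an `m`-bit
answer register and a workspace of dimension `w`. -/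
abbrev BasisState (n m w : ℕ) : Type := BitString n × BitString m × Fin w

/-- The query operator `O_f |x, y, z⟩ = |x, y ⊕ f x, z⟩`. -/
def queryOp {n m : ℕ} (w : ℕ) (f : BitString n → BitString m) :
    Matrix (BasisState n m w) (BasisState n m w) ℂ :=
  Matrix.of fun b' b => if b' = (b.1, b.2.1 + f b.1, b.2.2) then 1 else 0

/-- A quantum algorithm making `T` queries to `f : {0,1}^n → {0,1}^m`, with workspace dimension
`w` and results in `α`: a unit start vector, unitaries `U_0, …, U_T` that do not depend on `f`,
and a classical reading of the outcome of the final measurement in the computational basis. -/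
structure QueryAlgorithm (n m w T : ℕ) (α : Type) where
  start : BasisState n m w → ℂ
  start_unit : ∑ b, ‖start b‖ ^ 2 = 1
  U : Fin (T + 1) → Matrix.unitaryGroup (BasisState n m w) ℂ
  output : BasisState n m w → α

namespace QueryAlgorithm

variable {n m w T : ℕ} {α : Type}

/-- The state `U_t O_f U_{t-1} ⋯ U_1 O_f U_0 |start⟩` after `t` queries. -/
noncomputable def state (A : QueryAlgorithm n m w T α) (f : BitString n → BitString m)
    (t : Fin (T + 1)) : BasisState n m w → ℂ :=
  Fin.induction (motive := fun _ => BasisState n m w → ℂ)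
    (Matrix.mulVec (A.U 0).1 A.start)
    (fun i ψ => Matrix.mulVec (A.U i.succ).1 (Matrix.mulVec (queryOp w f) ψ)) t

open Classical in
/-- The probability that the algorithm, run on `f`, returns `a`. -/
noncomputable def outputProb (A : QueryAlgorithm n m w T α) (f : BitString n → BitString m)
    (a : α) : ℝ :=
  ∑ b with A.output b = a, ‖A.state f (Fin.last T) b‖ ^ 2

end QueryAlgorithm

/-- `A` solves the generalized Simon problem with parameters `n, m, k` exactly: on every `f`
satisfying the promise for some `S`, it returns the set `S` with probability `1`. -/
def SolvesSimonExactly {n m w T : ℕ} (k : ℕ)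
    (A : QueryAlgorithm n m w T (Set (BitString n))) : Prop :=
  ∀ (f : BitString n → BitString m) (S : Set (BitString n)),
    SimonPromise k f S → A.outputProb f S = 1

/-! This is the polynomial method. Put `k = e + 1` and run the algorithm on functions hiding a
random subspace of dimension `e + i`, for `0 ≤ i ≤ N = n - e`. The observable is the expected
proportion of the returned `2 ^ k`-element set that collides with `0`. It lies in `[0, 1]`, is at
most `1/2` at `i = 0`, where only `2 ^ (k - 1)` points collide with `0`, and is `1` at `i = 1` by
exactness. For `i ≥ 2` the promise for `k` fails and only the bounds `[0, 1]` are used.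

Amplitudes after `T` queries are combinations of events prescribing `f` on sets of points. Degree is
measured by the dimension of the span of those points, so `f 0` costs nothing and the observable has
degree `2 * T + 1`. Averaging over coordinate changes and relabellings turns it into a polynomial of
that degree in the subspace's cardinality (`exists_polynomial_sum_queryPolynomials`). A polynomial
with the above values at `2 ^ e, …, 2 ^ n` has degree at least `N`
(`le_natDegree_of_eval_geometric`), so `n - k + 1 ≤ 2 * T + 1`. -/

/-! ### Counting automorphisms that map a subspace into another. -/

section LinearCounting

open Module

theorem LinearIndependent.exists_linearEquiv_apply_eq {K V ι : Type*} [Field K] [AddCommGroup V]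
    [Module K V] [Finite ι] {v w : ι → V} (hv : LinearIndependent K v)
    (hw : LinearIndependent K w) : ∃ g : V ≃ₗ[K] V, ∀ i, g (v i) = w i := by
  have : FiniteDimensional K (Submodule.span K (Set.range v)) :=
    FiniteDimensional.span_of_finite K (Set.finite_range _)
  obtain ⟨g, hg⟩ := Submodule.exists_linearEquiv_restrict_eq
    (hv.linearCombinationEquiv.symm ≪≫ₗ hw.linearCombinationEquiv)
  refine ⟨g, fun i => ?_⟩
  have hi : hv.linearCombinationEquiv (Finsupp.single i 1) = v i := by simp
  have hi' : hw.linearCombinationEquiv (Finsupp.single i 1) = w i := by simp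
  rw [← hi, ← hg, ← hi']
  simp

variable {K V : Type*} [Field K] [AddCommGroup V] [Module K V]

/-- Sending `g` to `g ∘ v` fibres the automorphisms with `g ∘ v` in `E` over the linearly
independent tuples of `E`, all fibres being in bijection with the stabiliser of `v`. -/
theorem LinearIndependent.card_linearEquiv_forall_mem {u : ℕ} {v : Fin u → V}
    (hv : LinearIndependent K v) (E : Submodule K V) :
    Nat.card {g : V ≃ₗ[K] V // ∀ i, g (v i) ∈ E} =
      Nat.card {g : V ≃ₗ[K] V // ∀ i, g (v i) = v i} *
        Nat.card {s : Fin u → E // LinearIndependent K s} := by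
  have hE : ∀ s : {s : Fin u → E // LinearIndependent K s},
      ∃ h : V ≃ₗ[K] V, ∀ i, h (v i) = s.1 i := fun s =>
    hv.exists_linearEquiv_apply_eq (s.2.map' E.subtype E.ker_subtype)
  choose h hh using hE
  have hh' : ∀ s i, (h s).symm (s.1 i) = v i := fun s i => by
    rw [LinearEquiv.symm_apply_eq, hh]
  have hli : ∀ g : {g : V ≃ₗ[K] V // ∀ i, g (v i) ∈ E},
      LinearIndependent K (fun i => (⟨g.1 (v i), g.2 i⟩ : E)) := fun g =>
    LinearIndependent.of_comp E.subtype (hv.map' g.1.toLinearMap g.1.ker)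
  rw [← Nat.card_prod]
  refine Nat.card_congr
    { toFun := fun g => (⟨g.1 ≪≫ₗ (h ⟨_, hli g⟩).symm, fun i => hh' ⟨_, hli g⟩ i⟩, ⟨_, hli g⟩)
      invFun := fun p => ⟨p.1.1 ≪≫ₗ h p.2, fun i => by
        simp [p.1.2 i, hh]⟩
      left_inv := fun g => by
        ext x
        simp
      right_inv := fun p => by
        obtain ⟨⟨g, hg⟩, s⟩ := p
        have hs : (⟨fun i => ⟨h s (g (v i)), by simp [hg i, hh]⟩,
            hli ⟨g ≪≫ₗ h s, fun i => by simp [hg i, hh]⟩⟩ :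
              {s : Fin u → E // LinearIndependent K s}) = s := by
          ext i
          simp [hg i, hh]
        refine Prod.ext (Subtype.ext (LinearEquiv.ext fun x => ?_)) hs
        change (h ⟨_, _⟩).symm (h s (g x)) = g x
        rw [LinearEquiv.symm_apply_eq]
        exact congrArg (fun r => h r (g x)) hs.symm }

variable [Fintype K] [Finite V]

/-- For `u > finrank K E` both sides vanish, the product through its factor at `i = finrank K E`. So
one polynomial in `|E|` serves every `E`. -/
theorem natCast_card_linearIndependent (E : Submodule K V) (u : ℕ) :
    (Nat.card {s : Fin u → E // LinearIndependent K s} : ℂ) =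
      ∏ i : Fin u, ((Fintype.card K : ℂ) ^ finrank K E - (Fintype.card K : ℂ) ^ (i : ℕ)) := by
  rcases le_or_gt u (finrank K E) with hu | hu
  · rw [card_linearIndependent hu, Nat.cast_prod]
    refine Finset.prod_congr rfl fun i _ => ?_
    rw [Nat.cast_sub (Nat.pow_le_pow_right Fintype.card_pos (i.2.le.trans hu))]
    push_cast
    rfl
  · have : IsEmpty {s : Fin u → E // LinearIndependent K s} :=
      ⟨fun s => hu.not_ge (by simpa using s.2.fintype_card_le_finrank)⟩
    rw [Nat.card_of_isEmpty, Nat.cast_zero, eq_comm]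
    exact Finset.prod_eq_zero (Finset.mem_univ ⟨_, hu⟩) (sub_self _)

open Classical Polynomial in
-- The sum counts the `g` sending a basis of `W` into `E`: a stabiliser order independent of `E`,
-- times the number of independent tuples in `E`, which has one factor linear in `|E|` per basis
-- vector.
theorem exists_polynomial_sum_le_comap [Fintype (V ≃ₗ[K] V)] (W : Submodule K V) :
    ∃ Q : ℂ[X], Q.natDegree ≤ finrank K W ∧ ∀ E : Submodule K V,
      ∑ g : V ≃ₗ[K] V, (if W ≤ E.comap g.toLinearMap then (1 : ℂ) else 0) =
        Q.eval ((Fintype.card K : ℂ) ^ finrank K E) := by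
  have b := finBasis K W
  have hv : LinearIndependent K (fun i => (b i : V)) :=
    b.linearIndependent.map' W.subtype W.ker_subtype
  have hW : Submodule.span K (Set.range fun i => (b i : V)) = W := by
    have := congrArg (Submodule.map W.subtype) b.span_eq
    rw [Submodule.map_span, Submodule.map_top, Submodule.range_subtype, ← Set.range_comp] at this
    exact this
  refine ⟨C (Nat.card {g : V ≃ₗ[K] V // ∀ i, g (b i) = b i} : ℂ) *
    ∏ i : Fin (finrank K W), (X - C ((Fintype.card K : ℂ) ^ (i : ℕ))), ?_, fun E => ?_⟩
  · refine (natDegree_C_mul_le _ _).trans ?_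
    rw [natDegree_prod_of_monic _ _ fun i _ => monic_X_sub_C _]
    simp only [natDegree_X_sub_C]
    simp
  · have hiff : ∀ g : V ≃ₗ[K] V, W ≤ E.comap g.toLinearMap ↔ ∀ i, g (b i) ∈ E := fun g => by
      conv_lhs => rw [← hW]
      rw [Submodule.span_le, Set.range_subset_iff]
      rfl
    simp_rw [hiff]
    rw [Finset.sum_boole, ← Fintype.card_subtype, ← Nat.card_eq_fintype_card,
      hv.card_linearEquiv_forall_mem, Nat.cast_mul, natCast_card_linearIndependent]
    simp [eval_prod]

end LinearCounting

/-! ### Events about the hidden subspace and their averages. -/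

section KernelPatterns

open Module Polynomial

variable {K V : Type*} [Field K] [AddCommGroup V] [Module K V]

open Classical in
/-- The indicator, as a function of a subspace `H`, of the event `U ≤ H`. -/
noncomputable def containsIndicator (U : Submodule K V) : Submodule K V → ℂ :=
  fun H => if U ≤ H then 1 else 0

/-- The functions of a subspace `H` that are combinations of the events `U ≤ H` with `U ≤ W`. -/
noncomputable def kernelPatterns (W : Submodule K V) : Submodule ℂ (Submodule K V → ℂ) :=
  Submodule.span ℂ {φ | ∃ U ≤ W, φ = containsIndicator U}

theorem one_mem_kernelPatterns (W : Submodule K V) : 1 ∈ kernelPatterns W :=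
  Submodule.subset_span ⟨⊥, bot_le, by ext H; simp [containsIndicator]⟩

/-- Containing `U` and `U'` means containing `U ⊔ U'`, still inside `W`. Hence products do not raise
the degree bound `finrank K W`. -/
theorem mul_mem_kernelPatterns {W : Submodule K V} {φ ψ : Submodule K V → ℂ}
    (hφ : φ ∈ kernelPatterns W) (hψ : ψ ∈ kernelPatterns W) : φ * ψ ∈ kernelPatterns W := by
  have h := Submodule.mul_mem_mul hφ hψ
  rw [kernelPatterns, Submodule.span_mul_span] at h
  refine Submodule.span_mono ?_ h
  rintro _ ⟨_, ⟨U, hU, rfl⟩, _, ⟨U', hU', rfl⟩, rfl⟩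
  refine ⟨U ⊔ U', sup_le hU hU', ?_⟩
  ext H
  by_cases h1 : U ≤ H <;> by_cases h2 : U' ≤ H <;> simp [containsIndicator, h1, h2]

open Classical in
theorem mem_iff_indicator_mem_kernelPatterns {W : Submodule K V} {x : V} (hx : x ∈ W) (p : Prop)
    [Decidable p] :
    (fun H : Submodule K V => if x ∈ H ↔ p then (1 : ℂ) else 0) ∈ kernelPatterns W := by
  have h : containsIndicator (K ∙ x) ∈ kernelPatterns W :=
    Submodule.subset_span ⟨_, by simpa using hx, rfl⟩
  by_cases hp : p
  · convert h using 1
    ext H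
    simp [containsIndicator, hp]
  · convert (kernelPatterns W).sub_mem (one_mem_kernelPatterns W) h using 1
    ext H
    by_cases hH : x ∈ H <;> simp [containsIndicator, hp, hH]

theorem exists_polynomial_sum_kernelPatterns [Fintype K] [Finite V] [Fintype (V ≃ₗ[K] V)]
    {W : Submodule K V} {φ : Submodule K V → ℂ} (hφ : φ ∈ kernelPatterns W) :
    ∃ Q : ℂ[X], Q.natDegree ≤ finrank K W ∧ ∀ E : Submodule K V,
      ∑ g : V ≃ₗ[K] V, φ (E.comap g.toLinearMap) =
        Q.eval ((Fintype.card K : ℂ) ^ finrank K E) := by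
  induction hφ using Submodule.span_induction with
  | mem φ h =>
    obtain ⟨U, hU, rfl⟩ := h
    obtain ⟨Q, hQ, hE⟩ := exists_polynomial_sum_le_comap U
    exact ⟨Q, hQ.trans (Submodule.finrank_mono hU), hE⟩
  | zero => exact ⟨0, by simp, by simp⟩
  | add φ ψ _ _ h₁ h₂ =>
    obtain ⟨Q, hQ, hE⟩ := h₁
    obtain ⟨R, hR, hF⟩ := h₂
    exact ⟨Q + R, (natDegree_add_le _ _).trans (max_le hQ hR), fun E => by
      simp [Finset.sum_add_distrib, hE, hF]⟩
  | smul c φ _ h =>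
    obtain ⟨Q, hQ, hE⟩ := h
    exact ⟨C c * Q, (natDegree_C_mul_le _ _).trans hQ, fun E => by
      simp [← Finset.mul_sum, hE]⟩

end KernelPatterns

/-! ### Random relabelling of values. -/

section PermCounting

open Classical in
/-- The number of permutations carrying one finite family to another depends on the first only
through its coincidences. -/
theorem card_perm_map_eq {ι Y : Type*} [Finite ι] [Finite Y] (a y : ι → Y) :
    Nat.card {σ : Equiv.Perm Y // ∀ i, σ (a i) = y i} =
      if ∀ i j, a i = a j ↔ y i = y j then
        Nat.card {σ : Equiv.Perm Y // ∀ i, σ (y i) = y i} else 0 := by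
  split_ifs with h
  · have hsec : ∀ z : Set.range y, ∃ i, y i = z := fun z => z.2
    choose r hr using hsec
    obtain ⟨τ, hτ⟩ := Equiv.Perm.exists_extending_pair (fun z : Set.range y => (z : Y))
      (fun z => a (r z)) Subtype.val_injective fun z z' hz => by
        have := (h _ _).1 hz
        rw [hr, hr] at this
        exact Subtype.ext this
    have hτ' : ∀ i, τ (y i) = a i := fun i => by
      rw [hτ ⟨y i, i, rfl⟩, h]
      exact hr _
    refine Nat.card_congr ((Equiv.mulRight τ).subtypeEquiv fun σ => ?_)
    simp [hτ']
  · refine Nat.card_eq_zero.2 (Or.inl ⟨fun ⟨σ, hσ⟩ => h fun i j => ?_⟩)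
    rw [← hσ i, ← hσ j, σ.injective.eq_iff]

end PermCounting

/-! ### Query polynomials, graded by the dimension of the queried span. -/

section QueryPolynomials

open Module Polynomial

variable {X Y : Type*}

open Classical in
/-- The indicator, as a function of `f`, of the event that `f x = y` for all `(x, y)` in `C`. -/
noncomputable def passesIndicator (C : Finset (X × Y)) : (X → Y) → ℂ :=
  fun f => if ∀ c ∈ C, f c.1 = c.2 then 1 else 0

variable (K : Type*) [Field K] [AddCommGroup X] [Module K X]

/-- The combinations of events `∀ (x, y) ∈ C, f x = y` in which the points `x` prescribed by each
`C` span a space of dimension at most `t`. -/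
noncomputable def queryPolynomials (X Y : Type*) [AddCommGroup X] [Module K X] (t : ℕ) :
    Submodule ℂ ((X → Y) → ℂ) :=
  Submodule.span ℂ {φ | ∃ C : Finset (X × Y),
    finrank K (Submodule.span K (Prod.fst '' (C : Set (X × Y)))) ≤ t ∧ φ = passesIndicator C}

variable {K}

theorem one_mem_queryPolynomials (t : ℕ) : 1 ∈ queryPolynomials K X Y t :=
  Submodule.subset_span ⟨∅, by
    rw [Finset.coe_empty, Set.image_empty, Submodule.span_empty, finrank_bot]
    exact t.zero_le, by ext; simp [passesIndicator]⟩

theorem apply_eq_indicator_mem_queryPolynomials [DecidableEq Y] (x : X) (y : Y) :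
    (fun f : X → Y => if f x = y then (1 : ℂ) else 0) ∈ queryPolynomials K X Y 1 :=
  Submodule.subset_span ⟨{(x, y)}, by
    rw [Finset.coe_singleton, Set.image_singleton]
    simpa using finrank_span_le_card (R := K) ({x} : Set X),
    by ext; simp [passesIndicator]⟩

/-- The point `0` spans nothing, so reading `f 0` is free. -/
theorem apply_zero_eq_indicator_mem_queryPolynomials [DecidableEq Y] (y : Y) :
    (fun f : X → Y => if f 0 = y then (1 : ℂ) else 0) ∈ queryPolynomials K X Y 0 :=
  Submodule.subset_span ⟨{(0, y)}, by
    rw [Finset.coe_singleton, Set.image_singleton, Submodule.span_zero_singleton, finrank_bot],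
    by ext; simp [passesIndicator]⟩

theorem mul_mem_queryPolynomials [Finite X] {s t : ℕ} {φ ψ : (X → Y) → ℂ}
    (hφ : φ ∈ queryPolynomials K X Y s) (hψ : ψ ∈ queryPolynomials K X Y t) :
    φ * ψ ∈ queryPolynomials K X Y (s + t) := by
  classical
  have h := Submodule.mul_mem_mul hφ hψ
  rw [queryPolynomials, queryPolynomials, Submodule.span_mul_span] at h
  refine Submodule.span_mono ?_ h
  rintro _ ⟨_, ⟨C, hC, rfl⟩, _, ⟨D, hD, rfl⟩, rfl⟩
  refine ⟨C ∪ D, ?_, ?_⟩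
  · rw [Finset.coe_union, Set.image_union, Submodule.span_union]
    exact (Submodule.finrank_add_le_finrank_add_finrank _ _).trans (add_le_add hC hD)
  · ext f
    by_cases h1 : ∀ c ∈ C, f c.1 = c.2
    · by_cases h2 : ∀ c ∈ D, f c.1 = c.2
      · have h3 : ∀ c ∈ C ∪ D, f c.1 = c.2 := fun c hc =>
          (Finset.mem_union.1 hc).elim (h1 c) (h2 c)
        simp only [passesIndicator, Pi.mul_apply, if_pos h1, if_pos h2, if_pos h3, mul_one]
      · have h3 : ¬ ∀ c ∈ C ∪ D, f c.1 = c.2 := fun h =>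
          h2 fun c hc => h c (Finset.mem_union_right _ hc)
        simp only [passesIndicator, Pi.mul_apply, if_neg h2, if_neg h3, mul_zero]
    · have h3 : ¬ ∀ c ∈ C ∪ D, f c.1 = c.2 := fun h =>
        h1 fun c hc => h c (Finset.mem_union_left _ hc)
      simp only [passesIndicator, Pi.mul_apply, if_neg h1, if_neg h3, zero_mul]

theorem star_mem_queryPolynomials {t : ℕ} {φ : (X → Y) → ℂ}
    (hφ : φ ∈ queryPolynomials K X Y t) : star φ ∈ queryPolynomials K X Y t := by
  induction hφ using Submodule.span_induction with
  | mem φ h =>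
    obtain ⟨C, hC, rfl⟩ := h
    refine Submodule.subset_span ⟨C, hC, ?_⟩
    ext f
    simp only [passesIndicator, Pi.star_apply]
    split_ifs <;> simp
  | zero => simp
  | add φ ψ _ _ h₁ h₂ => simpa using Submodule.add_mem _ h₁ h₂
  | smul c φ _ h => simpa using Submodule.smul_mem _ _ h

/-- Averaged over relabellings of the values and over changes of coordinates, a function hiding a
subspace `E` sees a query polynomial of degree `t` as a polynomial in `|E|` of degree `t`. -/
theorem exists_polynomial_sum_queryPolynomials [Fintype K] [Finite X] [Fintype Y] [DecidableEq Y]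
    [Fintype (X ≃ₗ[K] X)] {t : ℕ} {φ : (X → Y) → ℂ} (hφ : φ ∈ queryPolynomials K X Y t) :
    ∃ Q : ℂ[X], Q.natDegree ≤ t ∧ ∀ (E : Submodule K X) (L : X → Y),
      (∀ x x', L x = L x' ↔ x - x' ∈ E) →
        ∑ g : X ≃ₗ[K] X, ∑ σ : Equiv.Perm Y, φ (fun x => σ (L (g x))) =
          Q.eval ((Fintype.card K : ℂ) ^ finrank K E) := by
  classical
  induction hφ using Submodule.span_induction with
  | mem φ h =>
    obtain ⟨D, hD, rfl⟩ := h
    set W := Submodule.span K (Prod.fst '' (D : Set (X × Y)))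
    -- `χ` tests whether the coincidences forced by hiding `H` are exactly those among the
    -- prescribed values. After averaging over `σ` nothing else about the function matters.
    let χ : Submodule K X → ℂ := ∏ c : D × D, fun H =>
      if c.1.1.1 - c.2.1.1 ∈ H ↔ c.1.1.2 = c.2.1.2 then 1 else 0
    have hχ : χ ∈ kernelPatterns W := by
      refine Finset.prod_induction _ (· ∈ kernelPatterns W)
        (fun _ _ => mul_mem_kernelPatterns) (one_mem_kernelPatterns W) fun c _ => ?_
      exact mem_iff_indicator_mem_kernelPatterns
        (W.sub_mem (Submodule.subset_span ⟨_, c.1.2, rfl⟩)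
          (Submodule.subset_span ⟨_, c.2.2, rfl⟩)) _
    obtain ⟨Q, hQ, hE⟩ := exists_polynomial_sum_kernelPatterns hχ
    let N : ℂ := Nat.card {σ : Equiv.Perm Y // ∀ c : D, σ c.1.2 = c.1.2}
    refine ⟨C N * Q, (natDegree_C_mul_le _ _).trans (hQ.trans hD), fun E L hL => ?_⟩
    rw [eval_mul, eval_C, ← hE E, Finset.mul_sum]
    refine Finset.sum_congr rfl fun g _ => ?_
    have hcard := card_perm_map_eq (fun c : D => L (g c.1.1)) (fun c : D => c.1.2)
    have hsum : ∑ σ : Equiv.Perm Y, passesIndicator D (fun x => σ (L (g x))) =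
        (Nat.card {σ : Equiv.Perm Y // ∀ c : D, σ (L (g c.1.1)) = c.1.2} : ℂ) := by
      rw [Nat.card_eq_fintype_card, Fintype.card_subtype, ← Finset.sum_boole]
      exact Finset.sum_congr rfl fun σ _ => by simp [passesIndicator]
    have hpat : χ (E.comap g.toLinearMap) =
        if ∀ c d : D, L (g c.1.1) = L (g d.1.1) ↔ c.1.2 = d.1.2 then 1 else 0 := by
      simp only [χ, Finset.prod_apply, hL, Submodule.mem_comap, map_sub]
      rw [Finset.prod_boole]
      congr 1
      simp [Prod.forall]
    rw [hsum, hcard, hpat]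
    split_ifs <;> simp [N]
  | zero => exact ⟨0, by simp, by simp⟩
  | add φ ψ _ _ h₁ h₂ =>
    obtain ⟨Q, hQ, hE⟩ := h₁
    obtain ⟨R, hR, hF⟩ := h₂
    exact ⟨Q + R, (natDegree_add_le _ _).trans (max_le hQ hR), fun E L hL => by
      simp [Finset.sum_add_distrib, hE E L hL, hF E L hL]⟩
  | smul c φ _ h =>
    obtain ⟨Q, hQ, hE⟩ := h
    exact ⟨C c * Q, (natDegree_C_mul_le _ _).trans hQ, fun E L hL => by
      simp [← Finset.mul_sum, hE E L hL]⟩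

end QueryPolynomials

/-! ### Degree lower bound from values on a geometric progression. -/

section GeometricNodes

open Polynomial

/-- The polynomial `∏_{j < N} (1 + X / 2 ^ j)`. -/
noncomputable def geomPoly (N : ℕ) : ℝ[X] :=
  ∏ j ∈ Finset.range N, (1 + C ((1 / 2 : ℝ) ^ j) * X)

theorem geomPoly_succ (N : ℕ) :
    geomPoly (N + 1) = geomPoly N + C ((1 / 2 : ℝ) ^ N) * (geomPoly N * X) := by
  rw [geomPoly, Finset.prod_range_succ, ← geomPoly]
  ring

theorem natDegree_geomPoly_le (N : ℕ) : (geomPoly N).natDegree ≤ N := by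
  refine (natDegree_prod_le _ _).trans ((Finset.sum_le_card_nsmul _ _ 1 fun j _ => ?_).trans ?_)
  · exact (natDegree_add_le _ _).trans
      (max_le (by simp) ((natDegree_C_mul_le _ _).trans natDegree_X_le))
  · simp

theorem coeff_geomPoly_nonneg (N i : ℕ) : 0 ≤ (geomPoly N).coeff i := by
  induction N generalizing i with
  | zero => simp only [geomPoly, Finset.range_zero, Finset.prod_empty, coeff_one]; positivity
  | succ N ih =>
    rw [geomPoly_succ, coeff_add, coeff_C_mul]
    cases i with
    | zero => simpa using ih 0
    | succ i =>
      rw [coeff_mul_X]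
      exact add_nonneg (ih _) (mul_nonneg (by positivity) (ih _))

theorem coeff_zero_geomPoly (N : ℕ) : (geomPoly N).coeff 0 = 1 := by
  induction N with
  | zero => simp [geomPoly]
  | succ N ih => simp [geomPoly_succ, ih]

theorem coeff_one_geomPoly (N : ℕ) : (geomPoly N).coeff 1 = 2 - 2 * (1 / 2 : ℝ) ^ N := by
  induction N with
  | zero => simp [geomPoly, coeff_one]
  | succ N ih =>
    rw [geomPoly_succ, coeff_add, coeff_C_mul, coeff_mul_X, coeff_zero_geomPoly, ih]
    ring

theorem eval_neg_two_pow_geomPoly {N j : ℕ} (hj : j < N) : (geomPoly N).eval (-2 ^ j) = 0 := by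
  rw [geomPoly, eval_prod]
  refine Finset.prod_eq_zero (Finset.mem_range.2 hj) ?_
  simp

/-- The correction term makes the induction close: with `y = (1/2) ^ N`, `(5 - 10 * y) * (1 + y) ≤ 5
- 5 * y`. Equality holds at `N = 3`, and the bound fails at `N = 2`. -/
theorem eval_one_geomPoly_le {N : ℕ} (hN : 3 ≤ N) :
    (geomPoly N).eval 1 ≤ 5 - 10 * (1 / 2 : ℝ) ^ N := by
  induction N, hN using Nat.le_induction with
  | base => norm_num [geomPoly, Finset.prod_range_succ]
  | succ N hN ih =>
    have hy : (0 : ℝ) < (1 / 2) ^ N := by positivity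
    rw [geomPoly_succ]
    simp only [eval_add, eval_mul, eval_C, eval_X, mul_one]
    rw [pow_succ]
    nlinarith

theorem eval_one_geomPoly_lt {N : ℕ} (hN : 2 ≤ N) :
    (geomPoly N).eval 1 < 5 - 4 * (1 / 2 : ℝ) ^ N := by
  rcases hN.eq_or_lt with rfl | hN
  · norm_num [geomPoly, Finset.prod_range_succ]
  · have hy : (0 : ℝ) < (1 / 2) ^ N := by positivity
    linarith [eval_one_geomPoly_le hN]

/-- The coefficients of `∏_{j < N} (1 - X / 2 ^ j)` annihilate the values of a polynomial of
degree less than `N` along the geometric progression `a, 2 a, 4 a, …`. -/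
theorem sum_coeff_geomPoly_mul_eval_eq_zero {N : ℕ} {Q : ℂ[X]} (hQ : Q.natDegree < N) (a : ℂ) :
    ∑ i ∈ Finset.range (N + 1),
      ((geomPoly N).coeff i : ℂ) * (-1) ^ i * Q.eval (a * 2 ^ i) = 0 := by
  have hj : ∀ j < N, ∑ i ∈ Finset.range (N + 1),
      ((geomPoly N).coeff i : ℂ) * (-1) ^ i * (2 ^ i) ^ j = 0 := fun j hj => by
    have h := eval_neg_two_pow_geomPoly hj
    rw [eval_eq_sum_range' (Nat.lt_succ_of_le (natDegree_geomPoly_le N))] at h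
    have h' := congrArg (fun r : ℝ => (r : ℂ)) h
    push_cast at h'
    rw [← h']
    refine Finset.sum_congr rfl fun i _ => ?_
    rw [neg_pow (2 ^ j : ℂ), ← pow_mul, ← pow_mul, mul_comm i j]
    ring
  simp_rw [eval_eq_sum_range' hQ, Finset.mul_sum]
  rw [Finset.sum_comm]
  refine Finset.sum_eq_zero fun j hjN => ?_
  rw [← mul_zero (Q.coeff j * a ^ j), ← hj j (Finset.mem_range.1 hjN), Finset.mul_sum]
  refine Finset.sum_congr rfl fun i _ => ?_
  rw [mul_pow]
  ring

/-- A polynomial that takes values in `[0, 1]` along `a, 2 a, …, 2 ^ N a`, at most `1 / 2` at `a`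
and `1` at `2 a`, has degree at least `N`. -/
theorem le_natDegree_of_eval_geometric {N : ℕ} (hN : 2 ≤ N) {Q : ℂ[X]} {a : ℂ} {q : ℕ → ℝ}
    (hq : ∀ i ≤ N, Q.eval (a * 2 ^ i) = q i) (hnonneg : ∀ i ≤ N, 0 ≤ q i)
    (hle : ∀ i ≤ N, q i ≤ 1) (h0 : q 0 ≤ 1 / 2) (h1 : q 1 = 1) : N ≤ Q.natDegree := by
  by_contra! hQ
  have hsum : ∑ i ∈ Finset.range (N + 1), (geomPoly N).coeff i * ((-1) ^ i * q i) = 0 := by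
    have h := sum_coeff_geomPoly_mul_eval_eq_zero hQ a
    rw [← Complex.ofReal_inj, Complex.ofReal_zero, ← h]
    push_cast
    refine Finset.sum_congr rfl fun i hi => ?_
    rw [hq i (Nat.lt_succ_iff.1 (Finset.mem_range.1 hi)), mul_assoc]
  have hneg : ∑ i ∈ Finset.range (N + 1), (geomPoly N).coeff i * (-1) ^ i = 0 := by
    rw [← eval_eq_sum_range' (Nat.lt_succ_of_le (natDegree_geomPoly_le N))]
    simpa using eval_neg_two_pow_geomPoly (N := N) (j := 0) (by omega)
  have hone : ∑ i ∈ Finset.range (N + 1), (geomPoly N).coeff i = (geomPoly N).eval 1 := by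
    rw [eval_eq_sum_range' (Nat.lt_succ_of_le (natDegree_geomPoly_le N))]
    simp
  -- From `0 ≤ q i ≤ 1` alone, `(-1) ^ i * q i` is at most `1` for even `i` and `0` for odd `i`. `d`
  -- is the amount saved by `q 0 ≤ 1 / 2` and `q 1 = 1`; it makes the alternating sum negative,
  -- although that sum must vanish.
  let d : ℕ → ℝ := fun i => if i = 0 then 1 / 2 else if i = 1 then 1 else 0
  have hd : ∑ i ∈ Finset.range (N + 1), (geomPoly N).coeff i * d i =
      1 / 2 + (2 - 2 * (1 / 2 : ℝ) ^ N) := by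
    rw [← Finset.sum_subset (s₁ := Finset.range 2) (by simp; omega)]
    · simp [Finset.sum_range_succ, d, coeff_zero_geomPoly, coeff_one_geomPoly]
    · intro i _ hi
      have : 1 < i := by simpa using hi
      simp [d, show i ≠ 0 by omega, show i ≠ 1 by omega]
  have hterm : ∀ i ∈ Finset.range (N + 1), (geomPoly N).coeff i * ((-1) ^ i * q i) ≤
      (geomPoly N).coeff i * ((1 + (-1) ^ i) / 2 - d i) := fun i hi => by
    have hi : i ≤ N := Nat.lt_succ_iff.1 (Finset.mem_range.1 hi)
    refine mul_le_mul_of_nonneg_left ?_ (coeff_geomPoly_nonneg N i)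
    have hn := hnonneg i hi
    have hl := hle i hi
    by_cases hi0 : i = 0
    · subst hi0; norm_num [d]; linarith
    by_cases hi1 : i = 1
    · subst hi1; norm_num [d, h1]
    simp only [d, if_neg hi0, if_neg hi1]
    rcases neg_one_pow_eq_or ℝ i with h | h <;> rw [h] <;> linarith
  have hbound := Finset.sum_le_sum hterm
  have hsplit : ∑ i ∈ Finset.range (N + 1), (geomPoly N).coeff i * ((1 + (-1) ^ i) / 2 - d i) =
      (geomPoly N).eval 1 / 2 + 0 / 2 - (1 / 2 + (2 - 2 * (1 / 2 : ℝ) ^ N)) := by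
    rw [← hd, ← hone, ← hneg, Finset.sum_div, Finset.sum_div, ← Finset.sum_add_distrib,
      ← Finset.sum_sub_distrib]
    exact Finset.sum_congr rfl fun i _ => by ring
  rw [hsum, hsplit] at hbound
  linarith [eval_one_geomPoly_lt hN]

end GeometricNodes

/-! ### Amplitudes and probabilities as query polynomials. -/

section QuantumQueries

open Matrix

variable {n m w T : ℕ} {α : Type}

theorem BitString.add_self (y : BitString n) : y + y = 0 :=
  funext fun _ => CharTwo.add_self_eq_zero _

theorem BitString.sub_eq_add (x y : BitString n) : x - y = x + y :=
  funext fun _ => CharTwo.sub_eq_add _ _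

theorem queryOp_mulVec (f : BitString n → BitString m) (ψ : BasisState n m w → ℂ)
    (b : BasisState n m w) : (queryOp w f *ᵥ ψ) b = ψ (b.1, b.2.1 + f b.1, b.2.2) := by
  have hb : ∀ b' : BasisState n m w, b = (b'.1, b'.2.1 + f b'.1, b'.2.2) ↔
      b' = (b.1, b.2.1 + f b.1, b.2.2) := fun b' => by
    constructor <;> intro h <;> rw [h] <;> simp [add_assoc, BitString.add_self]
  simp [mulVec, dotProduct, queryOp, hb]

theorem sum_norm_sq_queryOp_mulVec (f : BitString n → BitString m)
    (ψ : BasisState n m w → ℂ) : ∑ b, ‖(queryOp w f *ᵥ ψ) b‖ ^ 2 = ∑ b, ‖ψ b‖ ^ 2 := by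
  have hinv : Function.Involutive
      fun b : BasisState n m w => ((b.1, b.2.1 + f b.1, b.2.2) : BasisState n m w) := fun b => by
    simp [add_assoc, BitString.add_self]
  simp_rw [queryOp_mulVec]
  exact Equiv.sum_comp hinv.toPerm fun b => ‖ψ b‖ ^ 2

theorem sum_norm_sq_unitary_mulVec {ι : Type*} [Fintype ι] [DecidableEq ι]
    (U : unitaryGroup ι ℂ) (ψ : ι → ℂ) : ∑ b, ‖(U.1 *ᵥ ψ) b‖ ^ 2 = ∑ b, ‖ψ b‖ ^ 2 := by
  have hdot : ∀ v : ι → ℂ, ((∑ b, ‖v b‖ ^ 2 : ℝ) : ℂ) = star v ⬝ᵥ v := fun v => by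
    simp [dotProduct, Complex.conj_mul']
  rw [← Complex.ofReal_inj, hdot, hdot, star_mulVec, dotProduct_mulVec, vecMul_vecMul,
    ← star_eq_conjTranspose, mem_unitaryGroup_iff'.1 U.2, vecMul_one]

namespace QueryAlgorithm

variable (A : QueryAlgorithm n m w T α)

theorem state_zero (f : BitString n → BitString m) : A.state f 0 = (A.U 0).1 *ᵥ A.start := rfl

theorem state_succ (f : BitString n → BitString m) (i : Fin T) :
    A.state f i.succ = (A.U i.succ).1 *ᵥ (queryOp w f *ᵥ A.state f i.castSucc) := rfl

theorem sum_norm_sq_state (f : BitString n → BitString m) (t : Fin (T + 1)) :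
    ∑ b, ‖A.state f t b‖ ^ 2 = 1 := by
  induction t using Fin.induction with
  | zero => rw [state_zero, sum_norm_sq_unitary_mulVec, A.start_unit]
  | succ i ih => rw [state_succ, sum_norm_sq_unitary_mulVec, sum_norm_sq_queryOp_mulVec, ih]

/-- Unitaries only take linear combinations. A query splits according to the value `y` of `f` at one
point, which raises the degree by at most one. -/
theorem state_mem_queryPolynomials (t : Fin (T + 1)) (b : BasisState n m w) :
    (fun f => A.state f t b) ∈ queryPolynomials (ZMod 2) (BitString n) (BitString m) t := by
  classical
  induction t using Fin.induction generalizing b with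
  | zero =>
    simp only [state_zero]
    convert Submodule.smul_mem _ (((A.U 0).1 *ᵥ A.start) b) (one_mem_queryPolynomials _) using 1
    ext f
    simp
  | succ i ih =>
    have hquery : ∀ c, (fun f => (queryOp w f *ᵥ A.state f i.castSucc) c) ∈
        queryPolynomials (ZMod 2) (BitString n) (BitString m) (i + 1) := fun c => by
      have hsum : (fun f => (queryOp w f *ᵥ A.state f i.castSucc) c) =
          ∑ y : BitString m, (fun f => A.state f i.castSucc (c.1, c.2.1 + y, c.2.2)) *
            fun f => if f c.1 = y then (1 : ℂ) else 0 := by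
        ext f
        simp [queryOp_mulVec, Finset.sum_apply]
      rw [hsum]
      exact Submodule.sum_mem _ fun y _ => mul_mem_queryPolynomials (ih _)
        (apply_eq_indicator_mem_queryPolynomials _ _)
    have hsum : (fun f => A.state f i.succ b) =
        ∑ c, (A.U i.succ).1 b c • fun f => (queryOp w f *ᵥ A.state f i.castSucc) c := by
      ext f
      rw [state_succ, mulVec, dotProduct]
      simp [Finset.sum_apply]
    rw [hsum]
    exact Submodule.sum_mem _ fun c _ => Submodule.smul_mem _ _ (hquery c)

theorem norm_sq_state_mem_queryPolynomials (b : BasisState n m w) :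
    (fun f => ((‖A.state f (Fin.last T) b‖ ^ 2 : ℝ) : ℂ)) ∈
      queryPolynomials (ZMod 2) (BitString n) (BitString m) (2 * T) := by
  have h := A.state_mem_queryPolynomials (Fin.last T) b
  rw [Fin.val_last] at h
  rw [two_mul]
  convert mul_mem_queryPolynomials (star_mem_queryPolynomials h) h using 1
  ext f
  simp [Complex.conj_mul']

end QueryAlgorithm

end QuantumQueries

/-! ### The observable: collisions of the returned set with `0`. -/

section CollisionScore

variable {n m w T k : ℕ}

open Classical in
/-- The proportion of `s ∈ S` with `f s = f 0`, for a set `S` of `2 ^ k` elements. -/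
noncomputable def collisionRatio (k : ℕ) (S : Set (BitString n))
    (f : BitString n → BitString m) : ℝ :=
  if S.ncard = 2 ^ k then ({s ∈ S | f s = f 0}.ncard : ℝ) / 2 ^ k else 0

theorem collisionRatio_nonneg (S : Set (BitString n)) (f : BitString n → BitString m) :
    0 ≤ collisionRatio k S f := by
  unfold collisionRatio
  split_ifs <;> positivity

theorem collisionRatio_le_one (S : Set (BitString n)) (f : BitString n → BitString m) :
    collisionRatio k S f ≤ 1 := by
  unfold collisionRatio
  split_ifs with h
  · rw [div_le_one (by positivity)]
    exact_mod_cast (Set.ncard_le_ncard (Set.sep_subset _ _)).trans h.le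
  · exact zero_le_one

/-- A set of `2 ^ (e + 1)` points meets a fibre of `2 ^ e` points in at most half of its elements.
-/
theorem collisionRatio_le_half (S : Set (BitString n)) {f : BitString n → BitString m} {e : ℕ}
    (hf : {x | f x = f 0}.ncard = 2 ^ e) : collisionRatio (e + 1) S f ≤ 1 / 2 := by
  unfold collisionRatio
  split_ifs
  · have h : {s ∈ S | f s = f 0}.ncard ≤ 2 ^ e :=
      (Set.ncard_le_ncard fun x hx => hx.2).trans hf.le
    have h' : ({s ∈ S | f s = f 0}.ncard : ℝ) ≤ 2 ^ e := by exact_mod_cast h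
    rw [div_le_iff₀ (by positivity), pow_succ]
    linarith
  · positivity

theorem SimonPromise.collisionRatio_eq_one {S : Set (BitString n)} {f : BitString n → BitString m}
    (h : SimonPromise k f S) : collisionRatio k S f = 1 := by
  have hS : {s ∈ S | f s = f 0} = S :=
    Set.sep_eq_self_iff_mem_true.2 fun s hs => (h.2 s 0).2 (by simpa using hs)
  rw [collisionRatio, if_pos h.1, hS, h.1]
  push_cast
  exact div_self (by positivity)

/-- Each event `f s = f 0` involves two points, but `0` and `s` span at most a line. -/
theorem collisionRatio_mem_queryPolynomials (S : Set (BitString n)) :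
    (fun f => ((collisionRatio k S f : ℝ) : ℂ)) ∈
      queryPolynomials (ZMod 2) (BitString n) (BitString m) 1 := by
  classical
  by_cases hS : S.ncard = 2 ^ k
  · have hsum : (fun f => ((collisionRatio k S f : ℝ) : ℂ)) =
        (2 ^ k : ℂ)⁻¹ • ∑ s ∈ S.toFinset, ∑ y : BitString m,
          (fun f : BitString n → BitString m => if f 0 = y then (1 : ℂ) else 0) *
            fun f => if f s = y then (1 : ℂ) else 0 := by
      ext f
      have hset : {s ∈ S | f s = f 0} = (S.toFinset.filter fun s => f s = f 0 : Finset _) := by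
        ext s
        simp
      simp only [collisionRatio, if_pos hS, hset, Set.ncard_coe_finset]
      simp [Finset.sum_apply, div_eq_inv_mul, eq_comm]
    rw [hsum]
    refine Submodule.smul_mem _ _ (Submodule.sum_mem _ fun s _ => Submodule.sum_mem _ fun y _ => ?_)
    simpa using mul_mem_queryPolynomials (apply_zero_eq_indicator_mem_queryPolynomials y)
      (apply_eq_indicator_mem_queryPolynomials (K := ZMod 2) s y)
  · simp only [collisionRatio, if_neg hS, Complex.ofReal_zero]
    exact Submodule.zero_mem _

namespace QueryAlgorithm

variable (A : QueryAlgorithm n m w T (Set (BitString n)))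

/-- The expected collision ratio of the set that the algorithm returns. -/
noncomputable def collisionScore (k : ℕ) (f : BitString n → BitString m) : ℝ :=
  ∑ b, ‖A.state f (Fin.last T) b‖ ^ 2 * collisionRatio k (A.output b) f

theorem collisionScore_nonneg (f : BitString n → BitString m) : 0 ≤ A.collisionScore k f :=
  Finset.sum_nonneg fun _ _ => mul_nonneg (by positivity) (collisionRatio_nonneg _ _)

theorem collisionScore_le {f : BitString n → BitString m} {c : ℝ}
    (hc : ∀ S, collisionRatio k S f ≤ c) : A.collisionScore k f ≤ c := by
  rw [← one_mul c, ← A.sum_norm_sq_state f (Fin.last T), Finset.sum_mul]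
  exact Finset.sum_le_sum fun b _ => mul_le_mul_of_nonneg_left (hc _) (by positivity)

theorem collisionScore_eq_one (hA : SolvesSimonExactly k A) {f : BitString n → BitString m}
    {S : Set (BitString n)} (hf : SimonPromise k f S) : A.collisionScore k f = 1 := by
  classical
  refine le_antisymm (A.collisionScore_le fun S => collisionRatio_le_one S f) ?_
  rw [← hA f S hf, outputProb, Finset.sum_filter]
  refine Finset.sum_le_sum fun b _ => ?_
  split_ifs with h
  · rw [h, hf.collisionRatio_eq_one, mul_one]
  · exact mul_nonneg (by positivity) (collisionRatio_nonneg _ _)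

theorem collisionScore_mem_queryPolynomials :
    (fun f => ((A.collisionScore k f : ℝ) : ℂ)) ∈
      queryPolynomials (ZMod 2) (BitString n) (BitString m) (2 * T + 1) := by
  have hsum : (fun f => ((A.collisionScore k f : ℝ) : ℂ)) =
      ∑ b, (fun f => ((‖A.state f (Fin.last T) b‖ ^ 2 : ℝ) : ℂ)) *
        fun f => ((collisionRatio k (A.output b) f : ℝ) : ℂ) := by
    ext f
    simp [collisionScore, Finset.sum_apply]
  rw [hsum]
  exact Submodule.sum_mem _ fun b _ => mul_mem_queryPolynomials
    (A.norm_sq_state_mem_queryPolynomials b) (collisionRatio_mem_queryPolynomials _)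

end QueryAlgorithm

end CollisionScore

/-! ### Hidden subspaces of each dimension, and the bound on `T`. -/

section LowerBound

open Module

variable {n m : ℕ}

theorem exists_submodule_finrank_eq {e : ℕ} (he : e ≤ n) :
    ∃ E : Submodule (ZMod 2) (BitString n), finrank (ZMod 2) E = e := by
  have h := (Pi.basisFun (ZMod 2) (Fin n)).linearIndependent.comp (Fin.castLE he)
    (Fin.castLE_injective he)
  exact ⟨_, (finrank_span_eq_card h).trans (Fintype.card_fin e)⟩

/-- The quotient by `E` has at most `2 ^ n ≤ 2 ^ m` elements, so it embeds in the value set. -/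
theorem exists_hiding_function (hnm : n ≤ m) (E : Submodule (ZMod 2) (BitString n)) :
    ∃ L : BitString n → BitString m, ∀ x x', L x = L x' ↔ x - x' ∈ E := by
  classical
  have hcard : Nat.card (BitString n ⧸ E) ≤ Nat.card (BitString m) :=
    (Nat.card_le_card_of_surjective _ E.mkQ_surjective).trans (by
      simpa using Nat.pow_le_pow_right two_pos hnm)
  obtain ⟨j⟩ := Function.Embedding.nonempty_of_card_le
    (α := BitString n ⧸ E) (β := BitString m)
    (by rwa [← Nat.card_eq_fintype_card, ← Nat.card_eq_fintype_card])
  exact ⟨fun x => j (E.mkQ x), fun x x' => by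
    rw [j.injective.eq_iff, Submodule.mkQ_apply, Submodule.mkQ_apply, Submodule.Quotient.eq]⟩

/-- Relabelling the values and changing coordinates keeps the promise. -/
theorem simonPromise_perm_comp_linearEquiv {E : Submodule (ZMod 2) (BitString n)}
    {L : BitString n → BitString m} (hL : ∀ x x', L x = L x' ↔ x - x' ∈ E)
    (g : BitString n ≃ₗ[ZMod 2] BitString n) (σ : Equiv.Perm (BitString m)) :
    SimonPromise (finrank (ZMod 2) E) (fun x => σ (L (g x)))
      (E.comap g.toLinearMap : Set (BitString n)) := by
  refine ⟨?_, fun x y => ?_⟩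
  · have hfin : finrank (ZMod 2) (E.comap g.toLinearMap) = finrank (ZMod 2) E :=
      (g.submoduleMap _).finrank_eq.trans (by rw [Submodule.map_comap_eq_of_surjective g.surjective])
    have h := Module.natCard_eq_pow_finrank (K := ZMod 2) (V := E.comap g.toLinearMap)
    rw [hfin, Nat.card_zmod] at h
    exact h
  · rw [σ.injective.eq_iff, hL, ← map_sub, BitString.sub_eq_add]
    rfl

end LowerBound

theorem mainTheorem2 :
    ∃ c : ℝ, 0 < c ∧
      ∀ (n m k : ℕ), 1 ≤ k → k ≤ n → n ≤ m →
        ∀ (w T : ℕ) (A : QueryAlgorithm n m w T (Set (BitString n))),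
          SolvesSimonExactly k A → c * ((n : ℝ) - (k : ℝ)) ≤ (T : ℝ) := by

  classical
  refine ⟨1 / 2, by norm_num, fun n m k hk hkn hnm w T A hA => ?_⟩
  rcases hkn.eq_or_lt with rfl | hkn'
  · simp
  -- The progression starts one dimension below `k`, where exact answers are impossible to match;
  -- this needs `1 ≤ k`.
  obtain ⟨e, rfl⟩ : ∃ e, k = e + 1 := ⟨k - 1, by omega⟩
  have : Fintype (BitString n ≃ₗ[ZMod 2] BitString n) :=
    @Fintype.ofFinite _ (DFunLike.finite _)
  have hEL : ∀ i, ∃ (E : Submodule (ZMod 2) (BitString n)) (L : BitString n → BitString m),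
      (∀ x x', L x = L x' ↔ x - x' ∈ E) ∧
        (i ≤ n - e → Module.finrank (ZMod 2) E = e + i) := fun i => by
    by_cases hi : i ≤ n - e
    · obtain ⟨E, hE⟩ := exists_submodule_finrank_eq (n := n) (e := e + i) (by omega)
      obtain ⟨L, hL⟩ := exists_hiding_function hnm E
      exact ⟨E, L, hL, fun _ => hE⟩
    -- Default value outside the range of admissible dimensions, never evaluated below.
    · obtain ⟨L, hL⟩ := exists_hiding_function hnm (⊥ : Submodule (ZMod 2) (BitString n))
      exact ⟨⊥, L, hL, fun h => absurd h hi⟩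
  choose E L hL hE using hEL
  let F : ℕ → (BitString n ≃ₗ[ZMod 2] BitString n) × Equiv.Perm (BitString m) →
    BitString n → BitString m := fun i p x => p.2 (L i (p.1 x))
  have hF : ∀ i ≤ n - e, ∀ p, ∃ S, SimonPromise (e + i) (F i p) S := fun i hi p =>
    ⟨_, hE i hi ▸ simonPromise_perm_comp_linearEquiv (hL i) p.1 p.2⟩
  let q : ℕ → ℝ := fun i => Finset.expect Finset.univ fun p => A.collisionScore (e + 1) (F i p)
  obtain ⟨Q, hQ, hQE⟩ := exists_polynomial_sum_queryPolynomials
    (A.collisionScore_mem_queryPolynomials (k := e + 1))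
  let M : ℂ := Fintype.card
    ((BitString n ≃ₗ[ZMod 2] BitString n) × Equiv.Perm (BitString m))
  have hq : ∀ i ≤ n - e, (Polynomial.C M⁻¹ * Q).eval (2 ^ e * 2 ^ i) = q i := fun i hi => by
    have h := hQE (E i) (L i) (hL i)
    rw [hE i hi, ZMod.card] at h
    rw [Polynomial.eval_mul, Polynomial.eval_C, ← pow_add]
    simp only [q, Fintype.expect_eq_sum_div_card, Fintype.sum_prod_type, F]
    push_cast at h ⊢
    rw [← h, div_eq_inv_mul]
  -- The case `k = n` being settled, `n - e ≥ 2`.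
  have hdeg := le_natDegree_of_eval_geometric (N := n - e) (by omega) hq
    (fun i _ => Finset.expect_nonneg fun p _ => A.collisionScore_nonneg _)
    (fun i _ => Finset.expect_le Finset.univ_nonempty fun p _ =>
      A.collisionScore_le fun S => collisionRatio_le_one S _)
    (Finset.expect_le Finset.univ_nonempty fun p _ => A.collisionScore_le fun S => by
      obtain ⟨R, hR⟩ := hF 0 (Nat.zero_le _) p
      refine collisionRatio_le_half S ?_
      have hset : {x | F 0 p x = F 0 p 0} = R := by
        ext x
        simpa using hR.2 x 0
      rw [hset, hR.1, add_zero])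
    (by
      have h1 : ∀ p, A.collisionScore (e + 1) (F 1 p) = 1 := fun p => by
        obtain ⟨R, hR⟩ := hF 1 (by omega) p
        exact A.collisionScore_eq_one hA hR
      simp [q, h1])
  -- As `n - e = n - k + 1`, the extra degree of the collision ratio cancels, leaving `n - k ≤ 2 *
  -- T` and the constant `1 / 2`.
  have hT : n - e ≤ 2 * T + 1 := hdeg.trans ((Polynomial.natDegree_C_mul_le _ _).trans hQ)
  have hT' : (n : ℝ) ≤ 2 * T + 1 + e := by exact_mod_cast (by omega : n ≤ 2 * T + 1 + e)
  push_cast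
  linarith
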